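/- Let $0<k<1$ and let $N\ge 1$ be an integer. Let $\operatorname{sn} z,\operatorname{cn} z,\operatorname{dn} z$ be the Jacobi elliptic functions of modulus $k$ (parameter $m=k^2$), let $K=K(k)$ be the complete elliptic integral of the first kind, and put $T=2NK(k)$. Let $L^2_{\mathrm{per}}$ be the complex Hilbert space of $T$-periodic functions that are square integrable over one period, and let $H^2_{\mathrm{per}}\subset L^2_{\mathrm{per}}$ be the periodic Sobolev space of those $f$ whose Fourier coefficients $c_j=\frac1T\int_0^T f(z)e^{-2\pi i jz/T}\,dz$ satisfy $\sum_{j\in\mathbb Z}|c_j|^2(1+|j|^2+|j|^4)<\infty$. Consider the unbounded operators on $L^2_{\mathrm{per}}$, both with domain $H^2_{\mathrm{per}}$, $$L_-=-\frac{d^2}{dz^2}-2\operatorname{dn}^2 z-k^2+2,\qquad L_+=-\frac{d^2}{dz^2}-6\operatorname{dn}^2 z-k^2+2 .$$ Then: 1. $L_-$ is self-adjoint and non-negative ($\langle L_-f,f\rangle\ge 0$ for all $f\in H^2_{\mathrm{per}}$), and $\ker L_-=\operatorname{span}\{\operatorname{dn} z\}$. 2. $L_+$ is self-adjoint, and $\ker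 L_+=\operatorname{span}\{\operatorname{sn} z\operatorname{cn} z\}$. -/

import Mathlib

open MeasureTheory AddCircle
open scoped ENNReal

noncomputable section

namespace Jacobi

/-! ### Jacobi elliptic functions of modulus `k ∈ (0, 1)` on the real line -/

/-- The incomplete elliptic integral of the first kind
`F(φ, k) = ∫₀^φ dθ / √(1 - k² sin² θ)`. -/
def ellipticF (k φ : ℝ) : ℝ :=
  ∫ θ in (0 : ℝ)..φ, 1 / Real.sqrt (1 - k ^ 2 * Real.sin θ ^ 2)

/-- The complete elliptic integral of the first kind `K(k) = F(π/2, k)`. -/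
def ellipticK (k : ℝ) : ℝ := ellipticF k (Real.pi / 2)

/-- The Jacobi amplitude `am(z, k)`: the inverse function of `φ ↦ F(φ, k)`,
which is a bijection of the real line for `0 < k < 1` (see `ellipticF_am`, `am_ellipticF`). -/
def am (k z : ℝ) : ℝ := Function.invFun (ellipticF k) z

/-- `sn(z, k) = sin am(z, k)`. -/
def sn (k z : ℝ) : ℝ := Real.sin (am k z)

/-- `cn(z, k) = cos am(z, k)`. -/
def cn (k z : ℝ) : ℝ := Real.cos (am k z)

/-- `dn(z, k) = √(1 - k² sn²(z, k))`. -/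
def dn (k z : ℝ) : ℝ := Real.sqrt (1 - k ^ 2 * sn k z ^ 2)

variable {k : ℝ}

theorem radicand_pos (hk : k ∈ Set.Ioo (0 : ℝ) 1) (θ : ℝ) :
    0 < 1 - k ^ 2 * Real.sin θ ^ 2 := by
  have h1 : Real.sin θ ^ 2 ≤ 1 := Real.sin_sq_le_one θ
  have h2 : k ^ 2 < 1 := by have := hk.1; have := hk.2; nlinarith
  have h3 : 0 ≤ k ^ 2 := sq_nonneg k
  nlinarith

theorem continuous_integrand (hk : k ∈ Set.Ioo (0 : ℝ) 1) :
    Continuous fun θ : ℝ => 1 / Real.sqrt (1 - k ^ 2 * Real.sin θ ^ 2) := by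
  refine Continuous.div continuous_const (by fun_prop) fun θ => ?_
  exact (Real.sqrt_pos.2 (radicand_pos hk θ)).ne'

theorem one_le_integrand (hk : k ∈ Set.Ioo (0 : ℝ) 1) (θ : ℝ) :
    1 ≤ 1 / Real.sqrt (1 - k ^ 2 * Real.sin θ ^ 2) := by
  rw [le_div_iff₀ (Real.sqrt_pos.2 (radicand_pos hk θ)), one_mul]
  refine Real.sqrt_le_one.2 ?_
  have : 0 ≤ k ^ 2 * Real.sin θ ^ 2 := by positivity
  linarith

theorem hasDerivAt_ellipticF (hk : k ∈ Set.Ioo (0 : ℝ) 1) (φ : ℝ) :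
    HasDerivAt (ellipticF k) (1 / Real.sqrt (1 - k ^ 2 * Real.sin φ ^ 2)) φ :=
  (continuous_integrand hk).integral_hasStrictDerivAt 0 φ |>.hasDerivAt

theorem continuous_ellipticF (hk : k ∈ Set.Ioo (0 : ℝ) 1) : Continuous (ellipticF k) :=
  continuous_iff_continuousAt.2 fun φ => (hasDerivAt_ellipticF hk φ).continuousAt

theorem strictMono_ellipticF (hk : k ∈ Set.Ioo (0 : ℝ) 1) : StrictMono (ellipticF k) := by
  refine strictMono_of_deriv_pos fun φ => ?_
  rw [(hasDerivAt_ellipticF hk φ).deriv]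
  exact lt_of_lt_of_le one_pos (one_le_integrand hk φ)

theorem ellipticF_zero (k : ℝ) : ellipticF k 0 = 0 := by simp [ellipticF]

theorem sub_le_ellipticF_sub (hk : k ∈ Set.Ioo (0 : ℝ) 1) {a b : ℝ} (hab : a ≤ b) :
    b - a ≤ ellipticF k b - ellipticF k a := by
  have hm : Monotone fun φ => ellipticF k φ - φ := by
    refine monotone_of_deriv_nonneg
      (fun φ => ((hasDerivAt_ellipticF hk φ).sub (hasDerivAt_id φ)).differentiableAt) fun φ => ?_
    have h : deriv (fun φ => ellipticF k φ - φ) φ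
        = 1 / Real.sqrt (1 - k ^ 2 * Real.sin φ ^ 2) - 1 :=
      ((hasDerivAt_ellipticF hk φ).sub (hasDerivAt_id φ)).deriv
    rw [h]
    linarith [one_le_integrand hk φ]
  have := hm hab
  simp only at this
  linarith

theorem surjective_ellipticF (hk : k ∈ Set.Ioo (0 : ℝ) 1) :
    Function.Surjective (ellipticF k) := by
  refine (continuous_ellipticF hk).surjective ?_ ?_
  · refine Filter.tendsto_atTop_mono' _ ?_ Filter.tendsto_id
    filter_upwards [Filter.eventually_ge_atTop 0] with φ hφ
    have := sub_le_ellipticF_sub hk hφ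
    rw [ellipticF_zero] at this
    simpa using this
  · refine Filter.tendsto_atBot_mono' _ ?_ Filter.tendsto_id
    filter_upwards [Filter.eventually_le_atBot 0] with φ hφ
    have := sub_le_ellipticF_sub hk hφ
    rw [ellipticF_zero] at this
    simp only [id]
    linarith

theorem ellipticF_am (hk : k ∈ Set.Ioo (0 : ℝ) 1) (z : ℝ) : ellipticF k (am k z) = z :=
  Function.rightInverse_invFun (surjective_ellipticF hk) z

theorem am_ellipticF (hk : k ∈ Set.Ioo (0 : ℝ) 1) (φ : ℝ) : am k (ellipticF k φ) = φ :=
  Function.leftInverse_invFun (strictMono_ellipticF hk).injective φ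

theorem continuous_am (hk : k ∈ Set.Ioo (0 : ℝ) 1) : Continuous (am k) := by
  let e := (strictMono_ellipticF hk).orderIsoOfSurjective _ (surjective_ellipticF hk)
  have h : am k = e.symm := by
    funext z
    apply (strictMono_ellipticF hk).injective
    rw [ellipticF_am hk]
    exact (e.apply_symm_apply z).symm
  rw [h]
  exact e.symm.continuous

theorem ellipticK_pos (hk : k ∈ Set.Ioo (0 : ℝ) 1) : 0 < ellipticK k := by
  have := strictMono_ellipticF hk (half_pos Real.pi_pos)
  rwa [ellipticF_zero] at this

theorem ellipticF_add_pi (hk : k ∈ Set.Ioo (0 : ℝ) 1) (φ : ℝ) :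
    ellipticF k (φ + Real.pi) = ellipticF k φ + 2 * ellipticK k := by
  have hI : ∀ a b : ℝ, IntervalIntegrable
      (fun θ : ℝ => 1 / Real.sqrt (1 - k ^ 2 * Real.sin θ ^ 2)) volume a b :=
    fun a b => (continuous_integrand hk).intervalIntegrable a b
  have hper : Function.Periodic
      (fun θ : ℝ => 1 / Real.sqrt (1 - k ^ 2 * Real.sin θ ^ 2)) Real.pi := by
    intro θ
    simp [Real.sin_add_pi]
  have h1 : ellipticF k (φ + Real.pi) - ellipticF k φ = ellipticF k Real.pi := by
    unfold ellipticF
    rw [intervalIntegral.integral_interval_sub_left (hI _ _) (hI _ _)]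
    simpa using hper.intervalIntegral_add_eq φ 0
  have h2 : ellipticF k Real.pi - ellipticF k (Real.pi / 2) = ellipticF k (Real.pi / 2) := by
    unfold ellipticF
    rw [intervalIntegral.integral_interval_sub_left (hI _ _) (hI _ _)]
    have := intervalIntegral.integral_comp_sub_left
      (a := Real.pi / 2) (b := Real.pi)
      (fun θ : ℝ => 1 / Real.sqrt (1 - k ^ 2 * Real.sin θ ^ 2)) Real.pi
    simp only [Real.sin_pi_sub, sub_self] at this
    rw [this]
    congr 1
    ring
  unfold ellipticK
  linarith

theorem am_add_two_mul_ellipticK (hk : k ∈ Set.Ioo (0 : ℝ) 1) (z : ℝ) :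
    am k (z + 2 * ellipticK k) = am k z + Real.pi := by
  apply (strictMono_ellipticF hk).injective
  rw [ellipticF_am hk, ellipticF_add_pi hk, ellipticF_am hk]

theorem continuous_sn (hk : k ∈ Set.Ioo (0 : ℝ) 1) : Continuous (sn k) :=
  Real.continuous_sin.comp (continuous_am hk)

theorem continuous_cn (hk : k ∈ Set.Ioo (0 : ℝ) 1) : Continuous (cn k) :=
  Real.continuous_cos.comp (continuous_am hk)

theorem continuous_dn (hk : k ∈ Set.Ioo (0 : ℝ) 1) : Continuous (dn k) :=
  Real.continuous_sqrt.comp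
    (continuous_const.sub (continuous_const.mul ((continuous_sn hk).pow 2)))

theorem periodic_dn (hk : k ∈ Set.Ioo (0 : ℝ) 1) :
    Function.Periodic (dn k) (2 * ellipticK k) := by
  intro z
  simp [dn, sn, am_add_two_mul_ellipticK hk, Real.sin_add_pi]

theorem periodic_sn_mul_cn (hk : k ∈ Set.Ioo (0 : ℝ) 1) :
    Function.Periodic (fun z => sn k z * cn k z) (2 * ellipticK k) := by
  intro z
  simp [cn, sn, am_add_two_mul_ellipticK hk, Real.sin_add_pi, Real.cos_add_pi]

/-- The period `2 N K(k)`. -/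
def period (N : ℕ) (k : ℝ) : ℝ := 2 * N * ellipticK k

instance fact_period_pos (N : ℕ) [NeZero N] (k : Set.Ioo (0 : ℝ) 1) :
    Fact (0 < period N k) :=
  ⟨by
    have h1 : (0 : ℝ) < N := Nat.cast_pos.2 (Nat.pos_of_neZero N)
    have h2 := ellipticK_pos k.2
    unfold period
    positivity⟩

theorem periodic_period {f : ℝ → ℝ} (hf : Function.Periodic f (2 * ellipticK k)) (N : ℕ) :
    Function.Periodic f (period N k) := by
  have h := hf.nat_mul N
  have e : (N : ℝ) * (2 * ellipticK k) = period N k := by unfold period; ring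
  rwa [e] at h

end Jacobi

namespace PeriodicSchrodinger

/-! ### Functions on the circle `ℝ / Tℤ` and Schrödinger operators on `L²` -/

/-- A continuous `T`-periodic function on the line, as a continuous function on `ℝ / Tℤ`. -/
def toCircleFun {T : ℝ} (f : ℝ → ℝ) (hf : Function.Periodic f T) (hc : Continuous f) :
    C(AddCircle T, ℝ) where
  toFun := hf.lift
  continuous_toFun := continuous_coinduced_dom.2 hc

theorem toCircleFun_coe {T : ℝ} (f : ℝ → ℝ) (hf : Function.Periodic f T) (hc : Continuous f)
    (x : ℝ) : toCircleFun f hf hc (x : AddCircle T) = f x := rfl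

variable (T : ℝ) [hT : Fact (0 < T)]

/-- The complex Hilbert space `L²_per` of square integrable `T`-periodic functions. The inner
product is the one of the Haar probability measure, that is `T⁻¹` times the integral over one
period; this positive factor affects neither self-adjointness nor non-negativity. -/
abbrev L2per : Type := Lp ℂ 2 (haarAddCircle (T := T))

/-- The Fourier coefficients `c_j = T⁻¹ ∫ f(z) exp(-2πijz/T) dz` of `f ∈ L²_per` as a linear map. -/
def coeff (j : ℤ) : L2per T →ₗ[ℂ] ℂ where
  toFun f := fourierCoeff f j
  map_add' f g := by simp only [← fourierBasis_repr]; simp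
  map_smul' c f := by simp only [← fourierBasis_repr]; simp

variable {T} in
theorem coeff_apply (f : L2per T) (j : ℤ) : coeff T j f = fourierCoeff f j := rfl

/-- The weight `1 + |j|² + ⋯ + |j|^{2m}` of the Sobolev norm of order `m`. -/
def sobolevWeight (m : ℕ) (j : ℤ) : ℝ := ∑ i ∈ Finset.range (m + 1), |(j : ℝ)| ^ (2 * i)

theorem sobolevWeight_nonneg (m : ℕ) (j : ℤ) : 0 ≤ sobolevWeight m j :=
  Finset.sum_nonneg fun _ _ => by positivity

/-- The periodic Sobolev space `H^m_per`: all `f ∈ L²_per` with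
`∑_j |c_j|² (1 + |j|² + ⋯ + |j|^{2m}) < ∞`. -/
def Hper (m : ℕ) : Submodule ℂ (L2per T) where
  carrier := {f | Summable fun j : ℤ => ‖coeff T j f‖ ^ 2 * sobolevWeight m j}
  zero_mem' := by simp [summable_zero]
  add_mem' {f g} hf hg := by
    have hf' : Summable fun j : ℤ => ‖coeff T j f‖ ^ 2 * sobolevWeight m j := hf
    have hg' : Summable fun j : ℤ => ‖coeff T j g‖ ^ 2 * sobolevWeight m j := hg
    refine Summable.of_nonneg_of_le
      (fun j => mul_nonneg (sq_nonneg _) (sobolevWeight_nonneg m j)) (fun j => ?_)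
      ((hf'.add hg').mul_left 2)
    have h1 : ‖coeff T j (f + g)‖ ≤ ‖coeff T j f‖ + ‖coeff T j g‖ := by
      rw [map_add]; exact norm_add_le _ _
    have h2 : ‖coeff T j (f + g)‖ ^ 2 ≤ 2 * (‖coeff T j f‖ ^ 2 + ‖coeff T j g‖ ^ 2) := by
      nlinarith [norm_nonneg (coeff T j (f + g)), sq_nonneg (‖coeff T j f‖ - ‖coeff T j g‖)]
    nlinarith [sobolevWeight_nonneg m j]
  smul_mem' c f hf := by
    have hf' : Summable fun j : ℤ => ‖coeff T j f‖ ^ 2 * sobolevWeight m j := hf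
    have h : Summable fun j : ℤ => ‖c‖ ^ 2 * (‖coeff T j f‖ ^ 2 * sobolevWeight m j) :=
      hf'.mul_left _
    refine h.congr fun j => ?_
    rw [map_smul, norm_smul]
    ring

/-- The Fourier coefficients `(2πij/T)² c_j` of the second derivative of `f`. -/
def secondDerivCoeff (f : L2per T) (j : ℤ) : ℂ :=
  (2 * Real.pi * Complex.I * j / T) ^ 2 * coeff T j f

theorem memℓp_secondDerivCoeff (f : Hper T 2) :
    Memℓp (fun j : ℤ => secondDerivCoeff T (f : L2per T) j) 2 := by
  refine memℓp_gen ?_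
  have hf : Summable fun j : ℤ => ‖coeff T j (f : L2per T)‖ ^ 2 * sobolevWeight 2 j := f.2
  refine Summable.of_nonneg_of_le (fun j => by positivity) (fun j => ?_)
    (hf.mul_left ((2 * Real.pi / T) ^ 4))
  have hT0 : 0 < T := hT.out
  have e : ‖secondDerivCoeff T (f : L2per T) j‖ ^ 2
      = (2 * Real.pi / T) ^ 4 * (‖coeff T j (f : L2per T)‖ ^ 2 * |(j : ℝ)| ^ 4) := by
    simp only [secondDerivCoeff, norm_mul, norm_pow, norm_div, Complex.norm_I,
      Complex.norm_real, Complex.norm_intCast, Complex.norm_ofNat, Real.norm_eq_abs,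
      abs_of_pos Real.pi_pos, abs_of_pos hT0]
    field_simp
  have hw : |(j : ℝ)| ^ 4 ≤ sobolevWeight 2 j := by
    simp only [sobolevWeight, Finset.sum_range_succ, Finset.sum_range_zero]
    have h2 : 0 ≤ |(j : ℝ)| ^ (2 * 1) := by positivity
    norm_num at h2 ⊢
    linarith
  simp only [ENNReal.toReal_ofNat, Real.rpow_ofNat]
  rw [e]
  gcongr

/-- The second derivative `d²/dz² : H²_per → L²_per`, the function whose Fourier coefficients
are `(2πij/T)² c_j`. -/
def secondDeriv : Hper T 2 →ₗ[ℂ] L2per T where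
  toFun f := (fourierBasis (T := T)).repr.symm
    ⟨fun j => secondDerivCoeff T (f : L2per T) j, memℓp_secondDerivCoeff T f⟩
  map_add' f g := by
    rw [← map_add]
    congr 1
    ext j
    simp only [secondDerivCoeff, Submodule.coe_add, map_add, mul_add, lp.coeFn_add, Pi.add_apply]
  map_smul' c f := by
    rw [RingHom.id_apply, ← map_smul]
    congr 1
    ext j
    simp only [secondDerivCoeff, Submodule.coe_smul, map_smul, smul_eq_mul, lp.coeFn_smul,
      Pi.smul_apply]
    ring

variable {T}

theorem memLp_potential_mul (V : C(AddCircle T, ℝ)) (f : L2per T) :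
    MemLp (fun z => (V z : ℂ) * f z) 2 (haarAddCircle (T := T)) := by
  refine MemLp.of_le_mul (c := ‖V‖) (Lp.memLp f) ?_ (Filter.Eventually.of_forall fun z => ?_)
  · exact (Complex.continuous_ofReal.comp V.continuous).aestronglyMeasurable.mul
      (Lp.aestronglyMeasurable f)
  · rw [norm_mul, Complex.norm_real]
    exact mul_le_mul_of_nonneg_right (V.norm_coe_le_norm z) (norm_nonneg _)

/-- Multiplication by a continuous real function on `L²_per`. -/
def mulPotential (V : C(AddCircle T, ℝ)) : L2per T →ₗ[ℂ] L2per T where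
  toFun f := (memLp_potential_mul V f).toLp
  map_add' f g := by
    rw [← MemLp.toLp_add]
    refine MemLp.toLp_congr _ _ ?_
    filter_upwards [Lp.coeFn_add f g] with z hz
    rw [hz, Pi.add_apply, Pi.add_apply, mul_add]
  map_smul' c f := by
    rw [RingHom.id_apply, ← MemLp.toLp_const_smul]
    refine MemLp.toLp_congr _ _ ?_
    filter_upwards [Lp.coeFn_smul c f] with z hz
    simp only [hz, Pi.smul_apply, smul_eq_mul]
    ring

/-- The unbounded operator `-d²/dz² + V` on `L²_per` with domain `H²_per`. -/
def schrodinger (V : C(AddCircle T, ℝ)) : L2per T →ₗ.[ℂ] L2per T where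
  domain := Hper T 2
  toFun := -secondDeriv T + mulPotential V ∘ₗ (Hper T 2).subtype

/-- The class in `L²_per` of a continuous real function. -/
def toL2 (f : C(AddCircle T, ℝ)) : L2per T :=
  MemLp.toLp (μ := haarAddCircle (T := T)) (fun z => (f z : ℂ))
    ((⟨fun z => (f z : ℂ), by fun_prop⟩ : C(AddCircle T, ℂ)).memLp _ ℂ)

/-- The kernel of an unbounded operator on `L²_per`, as a subspace of `L²_per`. -/
def ker (A : L2per T →ₗ.[ℂ] L2per T) : Submodule ℂ (L2per T) :=
  (LinearMap.ker A.toFun).map A.domain.subtype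

end PeriodicSchrodinger

namespace Jacobi

open PeriodicSchrodinger

variable (N : ℕ) (k : Set.Ioo (0 : ℝ) 1)

/-- The function `dn z` on the circle of length `2 N K(k)`. -/
def dnCircle : C(AddCircle (period N k), ℝ) :=
  toCircleFun (dn k) (periodic_period (periodic_dn k.2) N) (continuous_dn k.2)

/-- The function `sn z cn z` on the circle of length `2 N K(k)`. -/
def sncnCircle : C(AddCircle (period N k), ℝ) :=
  toCircleFun (fun z => sn k z * cn k z) (periodic_period (periodic_sn_mul_cn k.2) N)
    ((continuous_sn k.2).mul (continuous_cn k.2))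

/-- The potential `-2 dn² z - k² + 2`. -/
def potentialMinus : C(AddCircle (period N k), ℝ) where
  toFun z := -2 * dnCircle N k z ^ 2 - (k : ℝ) ^ 2 + 2
  continuous_toFun := by fun_prop

/-- The potential `-6 dn² z - k² + 2`. -/
def potentialPlus : C(AddCircle (period N k), ℝ) where
  toFun z := -6 * dnCircle N k z ^ 2 - (k : ℝ) ^ 2 + 2
  continuous_toFun := by fun_prop

variable [NeZero N]

/-- `L₋ = -d²/dz² - 2 dn² z - k² + 2` on `2 N K(k)`-periodic functions. -/
def Lminus : L2per (period N k) →ₗ.[ℂ] L2per (period N k) :=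
  schrodinger (potentialMinus N k)

/-- `L₊ = -d²/dz² - 6 dn² z - k² + 2` on `2 N K(k)`-periodic functions. -/
def Lplus : L2per (period N k) →ₗ.[ℂ] L2per (period N k) :=
  schrodinger (potentialPlus N k)

end Jacobi

end

open MeasureTheory AddCircle
open scoped ENNReal

noncomputable section

/-! In the Fourier basis -d²/dz² is diagonal with real entries (2πj/T)², and the potential V is real
and bounded. Symmetry is therefore immediate, and testing the adjoint against exponentials shows
that its domain is no larger than H² (`isSelfAdjoint_schrodinger`). Elements of H² have C¹
representatives, so a kernel element is a classical periodic solution of u'' = V u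
(`mem_ker_iff_exists_isDeriv`), and both kernels are then found from constant Wronskians.

For L₋, the positive function dn is a periodic solution. With r = dn'/dn one has V = r' + r², and
integration by parts gives ⟨L₋f, f⟩ = ‖f' - r f‖². For any periodic solution u, (u/dn)' is a
constant times 1/dn²; integrating over a period forces that constant to vanish.

For L₊, differentiating dn'' = (2 - k²) dn - 2 dn³ shows that dn' = -k² sn cn is a solution. A
second one, `secondSol`, contains the secular factor J(z) = ∫₀ᶻ (dn² + α). Over a period T its value
returns while its derivative grows by k² J(T), and J(T) > 0 by a lower bound on ∫ dn²
(`lt_integral_dn_sq`). Comparing its Wronskian with a periodic solution u at 0 and T gives u(0) = 0,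
so u is a multiple of dn', which also vanishes at 0. -/

namespace PeriodicSchrodinger

/-! ### Derivatives of periodic functions -/

section

variable {T : ℝ}

theorem integral_deriv_eq_zero {F : C(AddCircle T, ℂ)} {F' : ℝ → ℂ}
    (h : ∀ x : ℝ, HasDerivAt (fun y : ℝ => F (y : AddCircle T)) (F' x) x) (hc : Continuous F') :
    ∫ x in (0 : ℝ)..T, F' x = 0 := by
  rw [intervalIntegral.integral_eq_sub_of_hasDerivAt (fun x _ => h x)
    (hc.intervalIntegrable _ _)]
  simp [AddCircle.coe_period]

/-- `p` is the derivative of `u`, both seen as periodic functions on the line. -/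
def IsDeriv (u p : C(AddCircle T, ℂ)) : Prop :=
  ∀ x : ℝ, HasDerivAt (fun y : ℝ => u (y : AddCircle T)) (p (x : AddCircle T)) x

theorem isDeriv_fourier (j : ℤ) :
    IsDeriv (fourier j : C(AddCircle T, ℂ))
      ((2 * Real.pi * Complex.I * j / T : ℂ) • fourier j) :=
  fun x => hasDerivAt_fourier T j x

theorem IsDeriv.const_smul {u p : C(AddCircle T, ℂ)} (h : IsDeriv u p) (c : ℂ) :
    IsDeriv (c • u) (c • p) := fun x => (h x).const_smul c

theorem IsDeriv.sum {ι : Type*} (s : Finset ι) {u p : ι → C(AddCircle T, ℂ)}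
    (h : ∀ i ∈ s, IsDeriv (u i) (p i)) : IsDeriv (∑ i ∈ s, u i) (∑ i ∈ s, p i) := by
  intro x
  simp only [ContinuousMap.coe_sum, Finset.sum_apply]
  exact HasDerivAt.fun_sum fun i hi => h i hi x

end

/-! ### Fourier coefficients and Sobolev regularity -/

variable {T : ℝ} [hT : Fact (0 < T)]

/-- The class in `L²_per` of a continuous complex function. -/
def contToL2 : C(AddCircle T, ℂ) →L[ℂ] L2per T :=
  ContinuousMap.toLp (E := ℂ) 2 haarAddCircle ℂ

theorem coeFn_contToL2 (u : C(AddCircle T, ℂ)) :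
    (contToL2 u : AddCircle T → ℂ) =ᵐ[haarAddCircle] u :=
  ContinuousMap.coeFn_toLp _ u

theorem coeff_contToL2 (u : C(AddCircle T, ℂ)) (j : ℤ) :
    coeff T j (contToL2 u) = fourierCoeff u j :=
  fourierCoeff_toLp u j

theorem contToL2_injective : Function.Injective (contToL2 (T := T)) :=
  ContinuousMap.toLp_injective _

theorem ext_coeff {f g : L2per T} (h : ∀ j, coeff T j f = coeff T j g) : f = g := by
  apply (fourierBasis (T := T)).repr.injective
  ext j
  rw [fourierBasis_repr, fourierBasis_repr]
  exact h j

theorem hasSum_coeff (f : L2per T) :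
    HasSum (fun j => coeff T j f • contToL2 (fourier j)) f :=
  hasSum_fourier_series_L2 f

theorem coeff_eq_inner (f : L2per T) (j : ℤ) :
    coeff T j f = inner ℂ (contToL2 (fourier j)) f := by
  rw [coeff_apply, ← fourierBasis_repr, HilbertBasis.repr_apply_apply, coe_fourierBasis]
  rfl

theorem continuous_coeff (j : ℤ) : Continuous (coeff T j) := by
  have : (coeff T j : L2per T → ℂ) = fun f => inner ℂ (contToL2 (fourier j)) f :=
    funext fun f => coeff_eq_inner f j
  rw [this]
  fun_prop

theorem coeff_fourier (i j : ℤ) :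
    coeff T j (contToL2 (fourier i)) = Pi.single (M := fun _ => ℂ) i 1 j := by
  rw [coeff_contToL2, fourierCoeff_fourier]

/-- Integration by parts: the derivative of exp(-2πijz/T) u is periodically integrated to zero. -/
theorem IsDeriv.fourierCoeff {u p : C(AddCircle T, ℂ)} (h : IsDeriv u p) (j : ℤ) :
    fourierCoeff p j = 2 * Real.pi * Complex.I * j / T * fourierCoeff u j := by
  have hd : ∀ x : ℝ, HasDerivAt
      (fun y : ℝ => (fourier (-j) * u : C(AddCircle T, ℂ)) (y : AddCircle T))
      (-2 * Real.pi * Complex.I * j / T * fourier (-j) (x : AddCircle T) * u x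
        + fourier (-j) (x : AddCircle T) * p x) x :=
    fun x => (hasDerivAt_fourier_neg T j x).mul (h x)
  have h0 := integral_deriv_eq_zero hd (by fun_prop)
  rw [intervalIntegral.integral_add (Continuous.intervalIntegrable (by fun_prop) _ _)
    (Continuous.intervalIntegrable (by fun_prop) _ _)] at h0
  simp only [mul_assoc (-2 * (Real.pi : ℂ) * Complex.I * j / T)] at h0
  rw [intervalIntegral.integral_const_mul] at h0
  rw [fourierCoeff_eq_intervalIntegral _ _ 0, fourierCoeff_eq_intervalIntegral _ _ 0]
  simp only [zero_add, smul_eq_mul, Complex.real_smul]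
  linear_combination (1 / T : ℝ) * h0

/-- A continuous function of mean zero has a periodic primitive. -/
theorem exists_primitive (g : C(AddCircle T, ℂ)) (h : fourierCoeff g 0 = 0) :
    ∃ G : C(AddCircle T, ℂ), IsDeriv G g := by
  have hgc : Continuous fun x : ℝ => g (x : AddCircle T) := by fun_prop
  have hI : ∀ a b : ℝ, IntervalIntegrable (fun x : ℝ => g (x : AddCircle T)) volume a b :=
    fun a b => hgc.intervalIntegrable a b
  have hmean : ∫ x in (0 : ℝ)..T, g (x : AddCircle T) = 0 := by
    rw [fourierCoeff_eq_intervalIntegral _ _ 0] at h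
    simpa [hT.out.ne'] using h
  have hper : Function.Periodic (fun x : ℝ => ∫ y in (0 : ℝ)..x, g (y : AddCircle T)) T := by
    intro x
    have hgp : Function.Periodic (fun x : ℝ => g (x : AddCircle T)) T := fun x => by simp
    have h1 := hgp.intervalIntegral_add_eq x 0
    rw [zero_add, hmean] at h1
    simp only
    rw [← intervalIntegral.integral_add_adjacent_intervals (hI 0 x) (hI x (x + T)), h1, add_zero]
  have hd : ∀ x : ℝ, HasDerivAt (fun x : ℝ => ∫ y in (0 : ℝ)..x, g (y : AddCircle T))
      (g (x : AddCircle T)) x := fun x => hgc.integral_hasStrictDerivAt 0 x |>.hasDerivAt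
  refine ⟨⟨hper.lift, continuous_coinduced_dom.2 ?_⟩, hd⟩
  exact continuous_iff_continuousAt.2 fun x => (hd x).continuousAt

/-- If the Fourier coefficients of `g` are those of the derivative of `p`, then `p` is
differentiable with derivative `g`. -/
theorem isDeriv_of_fourierCoeff {p g : C(AddCircle T, ℂ)}
    (h : ∀ j, fourierCoeff g j = 2 * Real.pi * Complex.I * j / T * fourierCoeff p j) :
    IsDeriv p g := by
  obtain ⟨G, hG⟩ := exists_primitive g (by simp [h 0])
  have hT0 : (T : ℂ) ≠ 0 := by exact_mod_cast hT.out.ne'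
  -- The primitive `G` has the coefficients of `p` at every j ≠ 0, so the two differ by a constant.
  have key : p = G + ContinuousMap.const _ (fourierCoeff p 0 - fourierCoeff G 0) := by
    apply contToL2_injective
    refine ext_coeff fun j => ?_
    have e : ContinuousMap.const (AddCircle T) (fourierCoeff p 0 - fourierCoeff G 0)
        = (fourierCoeff p 0 - fourierCoeff G 0) • (fourier 0 : C(AddCircle T, ℂ)) := by
      ext x; simp
    rw [e, map_add, map_add, map_smul, map_smul, coeff_fourier, coeff_contToL2, coeff_contToL2]
    by_cases hj : j = 0
    · subst hj; simp
    · rw [Pi.single_eq_of_ne hj, smul_zero, add_zero]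
      have h1 := h j
      rw [hG.fourierCoeff j] at h1
      have h2 : 2 * (Real.pi : ℂ) * Complex.I * j / T ≠ 0 := by
        simp [hj, Real.pi_ne_zero, Complex.I_ne_zero, hT0]
      exact (mul_left_cancel₀ h2 h1).symm
  rw [key]
  exact fun x => (hG x).add_const _

theorem exists_continuous_of_summable {c : ℤ → ℂ} (hc : Summable c) :
    ∃ u : C(AddCircle T, ℂ), ∀ j, fourierCoeff u j = c j := by
  have hs : Summable fun i => c i • (fourier i : C(AddCircle T, ℂ)) := by
    refine .of_norm ?_
    simp_rw [norm_smul, fourier_norm, mul_one]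
    exact hc.norm
  refine ⟨∑' i, c i • (fourier i : C(AddCircle T, ℂ)), fun j => ?_⟩
  let φ : C(AddCircle T, ℂ) →L[ℂ] ℂ :=
    (⟨coeff T j, continuous_coeff j⟩ : L2per T →L[ℂ] ℂ) ∘L contToL2
  have hφ : ∀ u : C(AddCircle T, ℂ), φ u = fourierCoeff u j := fun u => coeff_contToL2 u j
  rw [← hφ, φ.map_tsum hs, tsum_eq_single j]
  · rw [map_smul, hφ, fourierCoeff_fourier]; simp
  · intro i hi
    rw [map_smul, hφ, fourierCoeff_fourier, Pi.single_eq_of_ne hi.symm, smul_zero]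

theorem coeff_secondDeriv (f : Hper T 2) (j : ℤ) :
    coeff T j (secondDeriv T f) = secondDerivCoeff T (f : L2per T) j := by
  rw [coeff_apply, ← fourierBasis_repr]
  simp [secondDeriv]

theorem summable_sq_coeff (f : L2per T) : Summable fun j => ‖coeff T j f‖ ^ 2 :=
  (hasSum_sq_fourierCoeff f).summable

theorem norm_secondDerivCoeff_sq (f : L2per T) (j : ℤ) :
    ‖secondDerivCoeff T f j‖ ^ 2
      = (2 * Real.pi / T) ^ 4 * (‖coeff T j f‖ ^ 2 * (j : ℝ) ^ 4) := by
  have e4 : |(j : ℝ)| ^ 4 = (j : ℝ) ^ 4 := by exact (show Even 4 by decide).pow_abs _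
  simp only [secondDerivCoeff, norm_mul, norm_pow, norm_div, Complex.norm_I,
    Complex.norm_real, Complex.norm_intCast, Complex.norm_ofNat, Real.norm_eq_abs,
    abs_of_pos Real.pi_pos, abs_of_pos hT.out]
  rw [← e4]
  field_simp

/-- Square summability of c_j and of j² c_j suffices, because the middle weight j² is dominated by 1
+ j⁴. This is the criterion that identifies the domain of the adjoint. -/
theorem mem_Hper_of_coeff {f g : L2per T} (h : ∀ j, coeff T j g = secondDerivCoeff T f j) :
    f ∈ Hper T 2 := by
  have h1 := summable_sq_coeff f
  have h2 := summable_sq_coeff g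
  simp_rw [h, norm_secondDerivCoeff_sq] at h2
  have hne : (2 * Real.pi / T) ^ 4 ≠ 0 := pow_ne_zero _ (div_pos Real.two_pi_pos hT.out).ne'
  rw [summable_mul_left_iff hne] at h2
  refine Summable.of_nonneg_of_le
    (fun j => mul_nonneg (sq_nonneg _) (sobolevWeight_nonneg 2 j)) (fun j => ?_)
    ((h1.add h2).mul_left 2)
  simp only [sobolevWeight, Finset.sum_range_succ, Finset.sum_range_zero]
  have e2 : |(j : ℝ)| ^ (2 * 1) = (j : ℝ) ^ 2 := by simp
  have e4 : |(j : ℝ)| ^ (2 * 2) = (j : ℝ) ^ 4 := by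
    exact (show Even 4 by decide).pow_abs _
  rw [e2, e4]
  have hw : 0 + |(j : ℝ)| ^ (2 * 0) + (j : ℝ) ^ 2 + (j : ℝ) ^ 4 ≤ 2 * (1 + (j : ℝ) ^ 4) := by
    simp only [mul_zero, pow_zero, zero_add]
    nlinarith [sq_nonneg ((j : ℝ) ^ 2 - 1)]
  calc _ ≤ ‖coeff T j f‖ ^ 2 * (2 * (1 + (j : ℝ) ^ 4)) := by gcongr
    _ = _ := by ring

theorem secondDeriv_eq_of_coeff {f : Hper T 2} {g : L2per T}
    (h : ∀ j, coeff T j g = secondDerivCoeff T (f : L2per T) j) : secondDeriv T f = g :=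
  ext_coeff fun j => by rw [coeff_secondDeriv, h]

theorem coeff_of_isDeriv {u p g : C(AddCircle T, ℂ)} (hu : IsDeriv u p) (hp : IsDeriv p g)
    (j : ℤ) : coeff T j (contToL2 g) = secondDerivCoeff T (contToL2 u) j := by
  rw [secondDerivCoeff, coeff_contToL2, coeff_contToL2, hp.fourierCoeff, hu.fourierCoeff]
  ring

theorem contToL2_mem_Hper {u p g : C(AddCircle T, ℂ)} (hu : IsDeriv u p) (hp : IsDeriv p g) :
    contToL2 u ∈ Hper T 2 :=
  mem_Hper_of_coeff (coeff_of_isDeriv hu hp)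

theorem secondDeriv_contToL2 {u p g : C(AddCircle T, ℂ)} (hu : IsDeriv u p) (hp : IsDeriv p g) :
    secondDeriv T ⟨contToL2 u, contToL2_mem_Hper hu hp⟩ = contToL2 g :=
  secondDeriv_eq_of_coeff (coeff_of_isDeriv hu hp)

/-- Sobolev embedding H² ⊂ C¹: for j ≠ 0, 2|j||c_j| ≤ |c_j|² j⁴ + j⁻², and both terms are summable.
-/
theorem summable_int_mul_coeff (f : Hper T 2) :
    Summable fun j : ℤ => (1 + |(j : ℝ)|) * ‖coeff T j (f : L2per T)‖ := by
  have hf : Summable fun j : ℤ => ‖coeff T j (f : L2per T)‖ ^ 2 * sobolevWeight 2 j := f.2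
  have hz : Summable fun j : ℤ => 1 / |(j : ℝ)| ^ (2 : ℝ) :=
    Real.summable_one_div_int_add_rpow 0 2 |>.2 (by norm_num) |>.congr fun j => by simp
  -- Since 1 / 0 = 0, the term j = 0 needs its own 1 in the majorant.
  have hz' : Summable fun j : ℤ => (if j = 0 then (1 : ℝ) else 0) + 1 / |(j : ℝ)| ^ (2 : ℝ) :=
    (hasSum_ite_eq 0 1).summable.add hz
  refine Summable.of_nonneg_of_le (fun j => by positivity) (fun j => ?_) ((hf.mul_left 2).add hz')
  simp only [sobolevWeight, Finset.sum_range_succ, Finset.sum_range_zero]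
  have e2 : |(j : ℝ)| ^ (2 : ℝ) = |(j : ℝ)| ^ 2 := by norm_cast
  rw [e2]
  set a := ‖coeff T j (f : L2per T)‖
  have ha0 : 0 ≤ a := norm_nonneg _
  by_cases hj : j = 0
  · subst hj
    simp
    nlinarith [sq_nonneg (a - 1)]
  · have hb : 1 ≤ |(j : ℝ)| := by exact_mod_cast Int.one_le_abs hj
    set b := |(j : ℝ)|
    have hb0 : 0 < b := by linarith
    simp only [hj, if_false, mul_zero, pow_zero, zero_add, mul_one]
    have h1 : 2 * (b * a) ≤ a ^ 2 * b ^ 4 + 1 / b ^ 2 := by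
      have : 0 ≤ (a * b ^ 2 - 1 / b) ^ 2 := sq_nonneg _
      have e : (a * b ^ 2 - 1 / b) ^ 2 = a ^ 2 * b ^ 4 + 1 / b ^ 2 - 2 * (b * a) := by
        field_simp
        ring
      linarith
    have h2 : (1 + b) * a ≤ 2 * (b * a) := by nlinarith
    have h3 : 0 ≤ a ^ 2 * (1 + b ^ 2) + a ^ 2 * b ^ 4 := by positivity
    nlinarith [h3, sq_nonneg a, sq_nonneg (a * b)]

/-- Elements of `H²_per` are continuously differentiable. -/
theorem exists_isDeriv_of_mem_Hper (f : Hper T 2) :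
    ∃ u p : C(AddCircle T, ℂ), contToL2 u = f ∧ IsDeriv u p ∧
      ∀ j, fourierCoeff p j = 2 * Real.pi * Complex.I * j / T * coeff T j (f : L2per T) := by
  have hs := summable_int_mul_coeff f
  have h0 : Summable fun j => coeff T j (f : L2per T) :=
    .of_norm <| hs.of_nonneg_of_le (fun j => norm_nonneg _) fun j => by
      nlinarith [norm_nonneg (coeff T j (f : L2per T)), abs_nonneg (j : ℝ)]
  have h1 : Summable fun j : ℤ =>
      2 * Real.pi * Complex.I * j / T * coeff T j (f : L2per T) := by
    refine .of_norm <| (hs.mul_left (2 * Real.pi / T)).of_nonneg_of_le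
      (fun j => norm_nonneg _) fun j => ?_
    simp only [norm_mul, norm_div, Complex.norm_I, Complex.norm_real, Complex.norm_intCast,
      Complex.norm_ofNat, Real.norm_eq_abs, abs_of_pos Real.pi_pos, abs_of_pos hT.out]
    have : 0 ≤ 2 * Real.pi / T * ‖coeff T j (f : L2per T)‖ :=
      mul_nonneg (div_pos Real.two_pi_pos hT.out).le (norm_nonneg _)
    calc _ = 2 * Real.pi / T * (|(j : ℝ)| * ‖coeff T j (f : L2per T)‖) := by ring
      _ ≤ _ := by nlinarith
  obtain ⟨u, hu⟩ := exists_continuous_of_summable (T := T) h0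
  obtain ⟨p, hp⟩ := exists_continuous_of_summable (T := T) h1
  refine ⟨u, p, ext_coeff fun j => by rw [coeff_contToL2, hu], ?_, hp⟩
  exact isDeriv_of_fourierCoeff fun j => by rw [hp, hu]

/-- A continuous real function on the circle, as a complex function. -/
def ofRealCont (V : C(AddCircle T, ℝ)) : C(AddCircle T, ℂ) := ⟨fun z => (V z : ℂ), by fun_prop⟩

theorem toL2_eq_contToL2 (f : C(AddCircle T, ℝ)) : toL2 f = contToL2 (ofRealCont f) := by
  apply Lp.ext
  refine (MemLp.coeFn_toLp _).trans ?_
  exact (coeFn_contToL2 (ofRealCont f)).symm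

/-! ### Multiplication by the potential, and the kernel as classical solutions -/

theorem coeFn_mulPotential (V : C(AddCircle T, ℝ)) (f : L2per T) :
    (mulPotential V f : AddCircle T → ℂ) =ᵐ[haarAddCircle] fun z => (V z : ℂ) * f z :=
  MemLp.coeFn_toLp (memLp_potential_mul V f)

theorem mulPotential_contToL2 (V : C(AddCircle T, ℝ)) (u : C(AddCircle T, ℂ)) :
    mulPotential V (contToL2 u) = contToL2 (ofRealCont V * u) := by
  apply Lp.ext
  filter_upwards [coeFn_mulPotential V (contToL2 u), coeFn_contToL2 u,
    coeFn_contToL2 (ofRealCont V * u)] with z h1 h2 h3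
  rw [h1, h2, h3]
  rfl

theorem norm_mulPotential_le (V : C(AddCircle T, ℝ)) (f : L2per T) :
    ‖mulPotential V f‖ ≤ ‖V‖ * ‖f‖ := by
  refine Lp.norm_le_mul_norm_of_ae_le_mul ?_
  filter_upwards [coeFn_mulPotential V f] with z hz
  rw [hz, norm_mul, Complex.norm_real]
  exact mul_le_mul_of_nonneg_right (V.norm_coe_le_norm z) (norm_nonneg _)

theorem continuous_mulPotential (V : C(AddCircle T, ℝ)) : Continuous (mulPotential V) :=
  ((mulPotential V).mkContinuous ‖V‖ (norm_mulPotential_le V)).continuous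

theorem inner_mulPotential (V : C(AddCircle T, ℝ)) (f g : L2per T) :
    inner ℂ (mulPotential V f) g = inner ℂ f (mulPotential V g) := by
  rw [L2.inner_def, L2.inner_def]
  refine integral_congr_ae ?_
  filter_upwards [coeFn_mulPotential V f, coeFn_mulPotential V g] with z h1 h2
  rw [h1, h2]
  simp only [RCLike.inner_apply, map_mul, Complex.conj_ofReal]
  ring

theorem schrodinger_apply (V : C(AddCircle T, ℝ)) (f : Hper T 2) :
    schrodinger V f = -secondDeriv T f + mulPotential V (f : L2per T) := rfl

theorem mem_ker_iff {V : C(AddCircle T, ℝ)} {f : L2per T} :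
    f ∈ ker (schrodinger V) ↔
      ∃ h : f ∈ Hper T 2, secondDeriv T ⟨f, h⟩ = mulPotential V f := by
  constructor
  · rintro ⟨y, hy, rfl⟩
    refine ⟨y.2, ?_⟩
    have h1 : -secondDeriv T y + mulPotential V (y : L2per T) = 0 := hy
    exact (neg_add_eq_zero.1 h1)
  · rintro ⟨h, e⟩
    refine ⟨⟨f, h⟩, ?_, rfl⟩
    change -secondDeriv T ⟨f, h⟩ + mulPotential V f = 0
    rw [e, neg_add_cancel]

/-- Elements of the kernel of a Schrödinger operator are classical solutions. -/
theorem mem_ker_iff_exists_isDeriv {V : C(AddCircle T, ℝ)} {f : L2per T} :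
    f ∈ ker (schrodinger V) ↔
      ∃ u p : C(AddCircle T, ℂ), contToL2 u = f ∧ IsDeriv u p ∧ IsDeriv p (ofRealCont V * u) := by
  rw [mem_ker_iff]
  constructor
  · rintro ⟨h, e⟩
    obtain ⟨u, p, hu, hup, hp⟩ := exists_isDeriv_of_mem_Hper ⟨f, h⟩
    -- The weak second derivative equals V u, which is continuous, so matching coefficients make `p`
    -- classically differentiable.
    refine ⟨u, p, hu, hup, isDeriv_of_fourierCoeff fun j => ?_⟩
    rw [← coeff_contToL2, ← mulPotential_contToL2, hu, ← e, coeff_secondDeriv, hp,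
      secondDerivCoeff]
    ring
  · rintro ⟨u, p, rfl, hu, hp⟩
    exact ⟨contToL2_mem_Hper hu hp, by rw [secondDeriv_contToL2 hu hp, mulPotential_contToL2]⟩

/-! ### Self-adjointness -/

theorem secondDerivCoeff_eq_real_mul (f : L2per T) (j : ℤ) :
    secondDerivCoeff T f j = ((-(2 * Real.pi * j / T) ^ 2 : ℝ) : ℂ) * coeff T j f := by
  rw [secondDerivCoeff]
  push_cast
  congr 1
  have : 2 * (Real.pi : ℂ) * Complex.I * j / T = Complex.I * (2 * Real.pi * j / T) := by ring
  rw [this, mul_pow, Complex.I_sq]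
  ring

theorem fourier_mem_Hper (j : ℤ) : contToL2 (fourier j) ∈ Hper T 2 :=
  contToL2_mem_Hper (isDeriv_fourier j) ((isDeriv_fourier j).const_smul _)

theorem secondDeriv_fourier (j : ℤ) :
    secondDeriv T ⟨contToL2 (fourier j), fourier_mem_Hper j⟩ =
      ((-(2 * Real.pi * j / T) ^ 2 : ℝ) : ℂ) • contToL2 (fourier j) := by
  refine secondDeriv_eq_of_coeff fun i => ?_
  rw [secondDerivCoeff_eq_real_mul, map_smul, smul_eq_mul, coeff_fourier]
  by_cases h : i = j
  · rw [h]
  · rw [Pi.single_eq_of_ne h, mul_zero, mul_zero]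

theorem dense_Hper : Dense (Hper T 2 : Set (L2per T)) := by
  intro f
  refine mem_closure_of_tendsto (hasSum_coeff f) (Filter.Eventually.of_forall fun s => ?_)
  exact Submodule.sum_mem _ fun j _ => Submodule.smul_mem _ _ (fourier_mem_Hper j)

theorem inner_eq_tsum_coeff (f g : L2per T) :
    inner ℂ f g = ∑' j, inner ℂ (coeff T j f) (coeff T j g) := by
  rw [← (fourierBasis (T := T)).repr.inner_map_map, lp.inner_eq_tsum]
  simp only [fourierBasis_repr, coeff_apply]

theorem inner_secondDeriv (f g : Hper T 2) :
    inner ℂ (secondDeriv T f) (g : L2per T) = inner ℂ (f : L2per T) (secondDeriv T g) := by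
  rw [inner_eq_tsum_coeff, inner_eq_tsum_coeff]
  congr 1
  ext j
  simp only [coeff_secondDeriv, secondDerivCoeff_eq_real_mul, RCLike.inner_apply, map_mul,
    Complex.conj_ofReal]
  ring

theorem isFormalAdjoint_schrodinger (V : C(AddCircle T, ℝ)) :
    (schrodinger V).IsFormalAdjoint (schrodinger V) := by
  intro f g
  change inner ℂ (-secondDeriv T f + mulPotential V (f : L2per T)) (g : L2per T) =
    inner ℂ (f : L2per T) (-secondDeriv T g + mulPotential V (g : L2per T))
  change Hper T 2 at f g
  rw [inner_add_left, inner_add_right, inner_neg_left, inner_neg_right, inner_secondDeriv,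
    inner_mulPotential]

theorem isSelfAdjoint_schrodinger (V : C(AddCircle T, ℝ)) : IsSelfAdjoint (schrodinger V) := by
  have hd : Dense ((schrodinger V).domain : Set (L2per T)) := dense_Hper
  have hle := (isFormalAdjoint_schrodinger V).le_adjoint hd
  rw [LinearPMap.isSelfAdjoint_def]
  refine (LinearPMap.eq_of_le_of_domain_eq hle (le_antisymm hle.1 fun y hy => ?_)).symm
  have hadj := LinearPMap.adjoint_isFormalAdjoint hd ⟨y, hy⟩
  set w := (schrodinger V).adjoint ⟨y, hy⟩
  change y ∈ Hper T 2
  -- If `w` is the adjoint applied to `y`, then y'' should be V y - w, which lies in L²; pairing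
  -- with each exponential confirms this coefficientwise.
  refine mem_Hper_of_coeff (g := mulPotential V y - w) fun j => ?_
  have h1 : inner ℂ w (contToL2 (fourier j)) = inner ℂ y
      (-secondDeriv T ⟨contToL2 (fourier j), fourier_mem_Hper j⟩
        + mulPotential V (contToL2 (fourier j))) := hadj ⟨_, fourier_mem_Hper j⟩
  rw [secondDeriv_fourier, inner_add_right, inner_neg_right, inner_smul_right,
    ← inner_mulPotential, ← inner_conj_symm w, ← inner_conj_symm y,
    ← inner_conj_symm (mulPotential V y), ← coeff_eq_inner, ← coeff_eq_inner,
    ← coeff_eq_inner] at h1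
  have h2 := congrArg (starRingEnd ℂ) h1
  simp only [map_add, map_neg, map_mul, Complex.conj_conj, Complex.conj_ofReal] at h2
  rw [map_sub, secondDerivCoeff_eq_real_mul, h2]
  ring

/-! ### Non-negativity from a Riccati equation -/

theorem inner_contToL2 (u v : C(AddCircle T, ℂ)) :
    inner ℂ (contToL2 u) (contToL2 v) =
      (T⁻¹ : ℝ) • ∫ x in (0 : ℝ)..T, v (x : AddCircle T) * (starRingEnd ℂ) (u (x : AddCircle T)) := by
  have h1 : inner ℂ (contToL2 u) (contToL2 v) =
      ∫ z, v z * (starRingEnd ℂ) (u z) ∂(haarAddCircle (T := T)) := by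
    rw [L2.inner_def]
    refine integral_congr_ae ?_
    filter_upwards [coeFn_contToL2 u, coeFn_contToL2 v] with z hu hv
    rw [hu, hv]
    rfl
  rw [h1, integral_haarAddCircle,
    ← AddCircle.intervalIntegral_preimage T 0 (fun z => v z * (starRingEnd ℂ) (u z)), zero_add]

/-- If the potential is `r' + r²`, then `⟨-f'' + V f, f⟩ = ‖f' - r f‖²`. -/
theorem inner_nonneg_of_riccati {V r : C(AddCircle T, ℝ)}
    (hr : ∀ x : ℝ, HasDerivAt (fun y : ℝ => r (y : AddCircle T))
      (V (x : AddCircle T) - r (x : AddCircle T) ^ 2) x)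
    {u p g : C(AddCircle T, ℂ)} (hu : IsDeriv u p) (hp : IsDeriv p g) :
    0 ≤ (inner ℂ (contToL2 u) (contToL2 (-g + ofRealCont V * u))).re := by
  have hcu : ∀ x : ℝ, HasDerivAt (fun y : ℝ => (starRingEnd ℂ) (u (y : AddCircle T)))
      ((starRingEnd ℂ) (p (x : AddCircle T))) x := fun x => (hu x).star
  have hrc : ∀ x : ℝ, HasDerivAt (fun y : ℝ => (r (y : AddCircle T) : ℂ))
      ((V (x : AddCircle T) - r (x : AddCircle T) ^ 2 : ℝ) : ℂ) x := fun x => (hr x).ofReal_comp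
  -- The boundary term F = u' ū - r|u|² satisfies (-u'' + V u) ū - |u' - r u|² = -F', and F'
  -- integrates to zero over a period.
  let F : C(AddCircle T, ℂ) :=
    ⟨fun z => p z * (starRingEnd ℂ) (u z) - r z * (u z * (starRingEnd ℂ) (u z)), by fun_prop⟩
  let q : AddCircle T → ℂ := fun z => p z - r z * u z
  have hF := fun x : ℝ => ((hp x).mul (hcu x)).sub ((hrc x).mul ((hu x).mul (hcu x)))
  have h0 := integral_deriv_eq_zero (F := F) hF
    (by simp only [Pi.mul_apply]; fun_prop)
  simp only [Pi.mul_apply] at h0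
  rw [inner_contToL2]
  have hint : ∫ x in (0 : ℝ)..T, (-g + ofRealCont V * u) (x : AddCircle T) *
      (starRingEnd ℂ) (u (x : AddCircle T)) =
      ((∫ x in (0 : ℝ)..T, ‖q (x : AddCircle T)‖ ^ 2 : ℝ) : ℂ) := by
    rw [← intervalIntegral.integral_ofReal, ← sub_eq_zero, ← neg_eq_zero, ← h0,
      ← intervalIntegral.integral_sub (Continuous.intervalIntegrable (by fun_prop) _ _)
      (Continuous.intervalIntegrable (by fun_prop) _ _), ← intervalIntegral.integral_neg]
    refine intervalIntegral.integral_congr fun x _ => ?_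
    simp only [q, ofRealCont, ContinuousMap.add_apply, ContinuousMap.neg_apply,
      ContinuousMap.mul_apply, ContinuousMap.coe_mk]
    push_cast
    rw [← Complex.mul_conj']
    simp only [map_sub, map_mul, Complex.conj_ofReal]
    ring
  rw [hint, Complex.smul_re, Complex.ofReal_re]
  have := hT.out
  exact smul_nonneg (by positivity)
    (intervalIntegral.integral_nonneg this.le fun x _ => by positivity)

/-- The Riccati identity applies to trigonometric polynomials. Fourier partial sums of f'' are the
second derivatives of those of f, so both converge in L² and the inequality passes to the limit. -/
theorem schrodinger_nonneg_of_riccati {V r : C(AddCircle T, ℝ)}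
    (hr : ∀ x : ℝ, HasDerivAt (fun y : ℝ => r (y : AddCircle T))
      (V (x : AddCircle T) - r (x : AddCircle T) ^ 2) x) (f : Hper T 2) :
    0 ≤ (inner ℂ (f : L2per T) (schrodinger V f)).re := by
  rw [schrodinger_apply]
  have h1 := hasSum_coeff (f : L2per T)
  have h2 := hasSum_coeff (secondDeriv T f)
  have h3 : Filter.Tendsto (fun s : Finset ℤ => inner ℂ
      (∑ j ∈ s, coeff T j (f : L2per T) • contToL2 (fourier j))
      (-(∑ j ∈ s, coeff T j (secondDeriv T f) • contToL2 (fourier j)) +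
        mulPotential V (∑ j ∈ s, coeff T j (f : L2per T) • contToL2 (fourier j))))
      Filter.atTop (nhds (inner ℂ (f : L2per T)
        (-secondDeriv T f + mulPotential V (f : L2per T)))) :=
    h1.inner ((Filter.Tendsto.neg h2).add (((continuous_mulPotential V).tendsto _).comp h1))
  refine ge_of_tendsto' (Complex.continuous_re.continuousAt.tendsto.comp h3) fun s => ?_
  have hu := IsDeriv.sum s fun j _ =>
    (isDeriv_fourier (T := T) j).const_smul (coeff T j (f : L2per T))
  have hp := IsDeriv.sum s fun j _ => ((isDeriv_fourier (T := T) j).const_smul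
    (2 * Real.pi * Complex.I * j / T)).const_smul (coeff T j (f : L2per T))
  have key := inner_nonneg_of_riccati hr hu hp
  have e : ∑ j ∈ s, coeff T j (secondDeriv T f) • contToL2 (T := T) (fourier j) =
      ∑ j ∈ s, coeff T j (f : L2per T) • (2 * Real.pi * Complex.I * j / T : ℂ) •
        (2 * Real.pi * Complex.I * j / T : ℂ) • contToL2 (T := T) (fourier j) := by
    refine Finset.sum_congr rfl fun j _ => ?_
    rw [coeff_secondDeriv, secondDerivCoeff, smul_smul, smul_smul]
    congr 1
    ring
  rw [map_add, map_neg, ← mulPotential_contToL2] at key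
  simp only [map_sum, map_smul] at key
  simpa only [Function.comp_apply, map_sum, map_smul, e] using key

end PeriodicSchrodinger

/-! ### Wronskians and the differential equations for dn -/

namespace Jacobi

open PeriodicSchrodinger

theorem wronskian_eq {u p v r : ℝ → ℂ} {q : ℝ → ℂ} (hu : ∀ x, HasDerivAt u (p x) x)
    (hp : ∀ x, HasDerivAt p (q x * u x) x) (hv : ∀ x, HasDerivAt v (r x) x)
    (hr : ∀ x, HasDerivAt r (q x * v x) x) (x : ℝ) :
    u x * r x - p x * v x = u 0 * r 0 - p 0 * v 0 := by
  have hd : ∀ x, HasDerivAt (fun x => u x * r x - p x * v x) 0 x := fun x =>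
    (((hu x).mul (hr x)).sub ((hp x).mul (hv x))).congr_deriv (by ring)
  exact is_const_of_deriv_eq_zero (fun x => (hd x).differentiableAt) (fun x => (hd x).deriv) x 0

section

variable {k : ℝ}

theorem one_sub_sq_pos (hk : k ∈ Set.Ioo (0 : ℝ) 1) : 0 < 1 - k ^ 2 := by
  nlinarith [hk.1, hk.2]

theorem dn_pos (hk : k ∈ Set.Ioo (0 : ℝ) 1) (z : ℝ) : 0 < dn k z :=
  Real.sqrt_pos.2 (radicand_pos hk _)

theorem dn_sq (hk : k ∈ Set.Ioo (0 : ℝ) 1) (z : ℝ) : dn k z ^ 2 = 1 - k ^ 2 * sn k z ^ 2 :=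
  Real.sq_sqrt (radicand_pos hk _).le

theorem sn_sq_add_cn_sq (z : ℝ) : sn k z ^ 2 + cn k z ^ 2 = 1 := Real.sin_sq_add_cos_sq _

theorem am_zero (hk : k ∈ Set.Ioo (0 : ℝ) 1) : am k 0 = 0 := by
  simpa [ellipticF_zero] using am_ellipticF hk 0

theorem sn_zero (hk : k ∈ Set.Ioo (0 : ℝ) 1) : sn k 0 = 0 := by simp [sn, am_zero hk]

theorem dn_zero (hk : k ∈ Set.Ioo (0 : ℝ) 1) : dn k 0 = 1 := by simp [dn, sn_zero hk]

theorem hasDerivAt_am (hk : k ∈ Set.Ioo (0 : ℝ) 1) (z : ℝ) :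
    HasDerivAt (am k) (dn k z) z := by
  have h := HasDerivAt.of_local_left_inverse (continuous_am hk).continuousAt
    (hasDerivAt_ellipticF hk (am k z)) (one_div_pos.2 (dn_pos hk z)).ne'
    (Filter.Eventually.of_forall (ellipticF_am hk))
  rwa [one_div, inv_inv] at h

theorem hasDerivAt_sn (hk : k ∈ Set.Ioo (0 : ℝ) 1) (z : ℝ) :
    HasDerivAt (sn k) (cn k z * dn k z) z := (hasDerivAt_am hk z).sin

theorem hasDerivAt_cn (hk : k ∈ Set.Ioo (0 : ℝ) 1) (z : ℝ) :
    HasDerivAt (cn k) (-sn k z * dn k z) z := (hasDerivAt_am hk z).cos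

/-- The derivative `-k² sn z cn z` of `dn z`. -/
def dnDeriv (k z : ℝ) : ℝ := -k ^ 2 * (sn k z * cn k z)

theorem hasDerivAt_dn (hk : k ∈ Set.Ioo (0 : ℝ) 1) (z : ℝ) :
    HasDerivAt (dn k) (dnDeriv k z) z := by
  have h := ((((hasDerivAt_sn hk z).pow 2).const_mul (k ^ 2)).const_sub 1).sqrt
    (radicand_pos hk _).ne'
  refine h.congr_deriv ?_
  change _ / (2 * dn k z) = _
  have := (dn_pos hk z).ne'
  unfold dnDeriv
  field_simp
  ring

theorem hasDerivAt_dnDeriv (hk : k ∈ Set.Ioo (0 : ℝ) 1) (z : ℝ) :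
    HasDerivAt (dnDeriv k) ((2 - k ^ 2) * dn k z - 2 * dn k z ^ 3) z := by
  refine (((hasDerivAt_sn hk z).mul (hasDerivAt_cn hk z)).const_mul (-k ^ 2)).congr_deriv ?_
  linear_combination (-k ^ 2 * dn k z) * sn_sq_add_cn_sq (k := k) z + 2 * dn k z * dn_sq hk z

/-- The energy integral of dn'' = (2 - k²) dn - 2 dn³; it turns every even power of dn' into a
polynomial in dn. -/
theorem dnDeriv_sq (hk : k ∈ Set.Ioo (0 : ℝ) 1) (z : ℝ) :
    dnDeriv k z ^ 2 = -dn k z ^ 4 + (2 - k ^ 2) * dn k z ^ 2 - (1 - k ^ 2) := by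
  have h1 := sn_sq_add_cn_sq (k := k) z
  have h2 := dn_sq hk z
  have h3 : dn k z ^ 4 = (1 - k ^ 2 * sn k z ^ 2) ^ 2 := by rw [← h2]; ring
  unfold dnDeriv
  rw [h3, h2]
  linear_combination k ^ 4 * sn k z ^ 2 * h1

/-- Serves twice: as the Riccati equation for L₋, and, integrated over a period, as ∫ dn² = (1 - k²)
∫ dn⁻². -/
theorem hasDerivAt_dnDeriv_div_dn (hk : k ∈ Set.Ioo (0 : ℝ) 1) (z : ℝ) :
    HasDerivAt (fun z => dnDeriv k z / dn k z)
      (-dn k z ^ 2 + (1 - k ^ 2) / dn k z ^ 2) z := by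
  have := (dn_pos hk z).ne'
  refine ((hasDerivAt_dnDeriv hk z).div (hasDerivAt_dn hk z) this).congr_deriv ?_
  have h := dnDeriv_sq hk z
  field_simp
  linear_combination -h

/-! ### The non-periodic second solution for L₊ -/

theorem periodic_dnDeriv (hk : k ∈ Set.Ioo (0 : ℝ) 1) :
    Function.Periodic (dnDeriv k) (2 * ellipticK k) := fun z => by
  have := periodic_sn_mul_cn hk z
  simp only at this
  rw [dnDeriv, this, dnDeriv]

theorem dnDeriv_zero (hk : k ∈ Set.Ioo (0 : ℝ) 1) : dnDeriv k 0 = 0 := by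
  simp [dnDeriv, sn_zero hk]

/-- A lower bound for the complete elliptic integral of the second kind. -/
theorem lt_integral_dn_sq (hk : k ∈ Set.Ioo (0 : ℝ) 1) {T : ℝ} (hT : 0 < T)
    (hd : Function.Periodic (dn k) T) (hd' : Function.Periodic (dnDeriv k) T) :
    2 * (1 - k ^ 2) * T < (2 - k ^ 2) * ∫ z in (0 : ℝ)..T, dn k z ^ 2 := by
  have hq := one_sub_sq_pos hk
  have hc := continuous_dn hk
  have hne : ∀ z, dn k z ^ 2 ≠ 0 := fun z => pow_ne_zero 2 (dn_pos hk z).ne'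
  have hc2 : Continuous fun z => (1 - k ^ 2) / dn k z ^ 2 :=
    continuous_const.div (hc.pow 2) hne
  have h0 : ∫ z in (0 : ℝ)..T, (-dn k z ^ 2 + (1 - k ^ 2) / dn k z ^ 2) = 0 := by
    rw [intervalIntegral.integral_eq_sub_of_hasDerivAt
      (fun z _ => hasDerivAt_dnDeriv_div_dn hk z)
      (((hc.pow 2).neg.add hc2).intervalIntegrable _ _)]
    have h1 := hd 0
    have h2 := hd' 0
    rw [zero_add] at h1 h2
    rw [h1, h2, sub_self]
  set s := Real.sqrt (1 - k ^ 2)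
  have hs0 : 0 < s := Real.sqrt_pos.2 hq
  have hs2 : s ^ 2 = 1 - k ^ 2 := Real.sq_sqrt hq.le
  have hs1 : s < 1 := by nlinarith [hk.1, sq_pos_of_pos hk.1]
  -- With s = √(1 - k²), integrating dn² + s²/dn² ≥ 2s gives ∫ dn² ≥ sT. The claim follows since (1
  -- + s²)s - 2s² = s(1 - s)² > 0.
  have h1 : ∫ z in (0 : ℝ)..T, 2 * s ≤
      ∫ z in (0 : ℝ)..T, (2 * dn k z ^ 2 + (-dn k z ^ 2 + (1 - k ^ 2) / dn k z ^ 2)) := by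
    refine intervalIntegral.integral_mono hT.le (continuous_const.intervalIntegrable _ _)
      (Continuous.intervalIntegrable (by fun_prop) _ _) fun z => ?_
    have hz := dn_pos hk z
    have h : 0 ≤ (dn k z - s / dn k z) ^ 2 := sq_nonneg _
    have e : (dn k z - s / dn k z) ^ 2 = dn k z ^ 2 + (1 - k ^ 2) / dn k z ^ 2 - 2 * s := by
      rw [← hs2]
      field_simp
      ring
    simp only
    linarith
  rw [intervalIntegral.integral_add (Continuous.intervalIntegrable (by fun_prop) _ _)
    (Continuous.intervalIntegrable (by fun_prop) _ _), h0,
    intervalIntegral.integral_const_mul, intervalIntegral.integral_const_mul,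
    intervalIntegral.integral_const, smul_eq_mul] at h1
  set I := ∫ z in (0 : ℝ)..T, dn k z ^ 2
  have h2 : s * T ≤ I := by linarith
  have e1 : 2 - k ^ 2 = 1 + s ^ 2 := by linarith
  rw [e1, ← hs2]
  have h3 : 0 < s * T * (1 - s) ^ 2 := by
    have : 0 < 1 - s := by linarith
    positivity
  nlinarith [mul_le_mul_of_nonneg_left h2 (by positivity : 0 ≤ 1 + s ^ 2)]

/-- The constant `α` for which `∫₀ᶻ (dn² + α)` enters the second solution of `L₊ u = 0`. -/
def secondSolConst (k : ℝ) : ℝ := -2 * (1 - k ^ 2) / (2 - k ^ 2)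

theorem secondSolConst_mul (hk : k ∈ Set.Ioo (0 : ℝ) 1) :
    secondSolConst k * (2 - k ^ 2) = -2 * (1 - k ^ 2) :=
  div_mul_cancel₀ _ (by linarith [one_sub_sq_pos hk])

/-- `∫₀ᶻ (dn² + α)`. -/
def secondSolInt (k z : ℝ) : ℝ := ∫ y in (0 : ℝ)..z, (dn k y ^ 2 + secondSolConst k)

theorem hasDerivAt_secondSolInt (hk : k ∈ Set.Ioo (0 : ℝ) 1) (z : ℝ) :
    HasDerivAt (secondSolInt k) (dn k z ^ 2 + secondSolConst k) z :=
  ((continuous_dn hk).pow 2 |>.add continuous_const).integral_hasStrictDerivAt 0 z |>.hasDerivAt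

/-- The second solution of `L₊ u = 0`. -/
def secondSol (k z : ℝ) : ℝ :=
  -(secondSolInt k z * dnDeriv k z) - (2 - k ^ 2 + secondSolConst k) * dn k z + dn k z ^ 3

/-- The derivative of the second solution of `L₊ u = 0`. -/
def secondSolDeriv (k z : ℝ) : ℝ :=
  2 * dn k z ^ 2 * dnDeriv k z - (2 - k ^ 2 + 2 * secondSolConst k) * dnDeriv k z
    - secondSolInt k z * ((2 - k ^ 2) * dn k z - 2 * dn k z ^ 3)

theorem hasDerivAt_secondSol (hk : k ∈ Set.Ioo (0 : ℝ) 1) (z : ℝ) :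
    HasDerivAt (secondSol k) (secondSolDeriv k z) z := by
  have hd := hasDerivAt_dn hk z
  refine ((((hasDerivAt_secondSolInt hk z).mul (hasDerivAt_dnDeriv hk z)).neg.sub
    (hd.const_mul (2 - k ^ 2 + secondSolConst k))).add (hd.pow 3)).congr_deriv ?_
  unfold secondSolDeriv
  norm_num
  ring

/-- Since dn' is a solution, applying the operator to J dn' leaves only terms in J' and J'', which
are polynomial in dn and are compensated by the dn and dn³ terms. Matching the coefficient of dn
forces α(2 - k²) = -2(1 - k²). -/
theorem hasDerivAt_secondSolDeriv (hk : k ∈ Set.Ioo (0 : ℝ) 1) (z : ℝ) :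
    HasDerivAt (secondSolDeriv k) ((-6 * dn k z ^ 2 - k ^ 2 + 2) * secondSol k z) z := by
  have hd := hasDerivAt_dn hk z
  have hd' := hasDerivAt_dnDeriv hk z
  refine (((((hd.pow 2).const_mul 2).mul hd').sub
    (hd'.const_mul (2 - k ^ 2 + 2 * secondSolConst k))).sub
    ((hasDerivAt_secondSolInt hk z).mul
      ((hd.const_mul (2 - k ^ 2)).sub ((hd.pow 3).const_mul 2)))).congr_deriv ?_
  unfold secondSol
  norm_num
  linear_combination 4 * dn k z * dnDeriv_sq hk z - 2 * dn k z * secondSolConst_mul hk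

theorem secondSolInt_pos (hk : k ∈ Set.Ioo (0 : ℝ) 1) {T : ℝ} (hT : 0 < T)
    (hd : Function.Periodic (dn k) T) (hd' : Function.Periodic (dnDeriv k) T) :
    0 < secondSolInt k T := by
  have h := lt_integral_dn_sq hk hT hd hd'
  have e := secondSolConst_mul hk
  have hb : 0 < 2 - k ^ 2 := by linarith [one_sub_sq_pos hk]
  have hI : IntervalIntegrable (fun z => dn k z ^ 2) volume 0 T :=
    ((continuous_dn hk).pow 2).intervalIntegrable _ _
  rw [secondSolInt, intervalIntegral.integral_add hI (continuous_const.intervalIntegrable _ _),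
    intervalIntegral.integral_const, smul_eq_mul, sub_zero]
  refine pos_of_mul_pos_right ?_ hb.le
  linear_combination h - T * e

end

/-! ### The solutions as functions on the circle -/

variable (N : ℕ) (k : Set.Ioo (0 : ℝ) 1)

theorem periodic_dn_period : Function.Periodic (dn k) (period N k) :=
  periodic_period (periodic_dn k.2) N

theorem periodic_dnDeriv_period : Function.Periodic (dnDeriv k) (period N k) :=
  periodic_period (periodic_dnDeriv k.2) N

/-- The derivative of `dn z` on the circle of length `2 N K(k)`. -/
def dnDerivCircle : C(AddCircle (period N k), ℝ) := -(k : ℝ) ^ 2 • sncnCircle N k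

theorem dnCircle_coe (x : ℝ) : dnCircle N k (x : AddCircle (period N k)) = dn k x := rfl

theorem dnDerivCircle_coe (x : ℝ) :
    dnDerivCircle N k (x : AddCircle (period N k)) = dnDeriv k x := by
  change (-(k : ℝ) ^ 2) * (sn k x * cn k x) = _
  rfl

theorem isDeriv_dnCircle :
    IsDeriv (ofRealCont (dnCircle N k)) (ofRealCont (dnDerivCircle N k)) := fun x =>
  (hasDerivAt_dn k.2 x).ofReal_comp

theorem isDeriv_dnDerivCircle : IsDeriv (ofRealCont (dnDerivCircle N k))
    (ofRealCont (potentialMinus N k) * ofRealCont (dnCircle N k)) := fun x => by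
  refine (hasDerivAt_dnDeriv k.2 x).ofReal_comp.congr_deriv ?_
  change _ = ((-2 * dn k x ^ 2 - (k : ℝ) ^ 2 + 2 : ℝ) : ℂ) * (dn k x : ℂ)
  push_cast
  ring

/-- The second derivative of `dn z` on the circle of length `2 N K(k)`. -/
def dnDeriv₂Circle : C(AddCircle (period N k), ℝ) :=
  ⟨fun z => (2 - (k : ℝ) ^ 2) * dnCircle N k z - 2 * dnCircle N k z ^ 3, by fun_prop⟩

theorem isDeriv_dnDerivCircle' :
    IsDeriv (ofRealCont (dnDerivCircle N k)) (ofRealCont (dnDeriv₂Circle N k)) := fun x =>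
  (hasDerivAt_dnDeriv k.2 x).ofReal_comp

theorem hasDerivAt_dnDeriv₂ {k : ℝ} (hk : k ∈ Set.Ioo (0 : ℝ) 1) (x : ℝ) :
    HasDerivAt (fun x => (2 - k ^ 2) * dn k x - 2 * dn k x ^ 3)
      ((-6 * dn k x ^ 2 - k ^ 2 + 2) * dnDeriv k x) x := by
  have hd := hasDerivAt_dn hk x
  refine ((hd.const_mul (2 - k ^ 2)).sub ((hd.pow 3).const_mul 2)).congr_deriv ?_
  norm_num
  ring

theorem isDeriv_dnDeriv₂Circle : IsDeriv (ofRealCont (dnDeriv₂Circle N k))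
    (ofRealCont (potentialPlus N k) * ofRealCont (dnDerivCircle N k)) := fun x =>
  (hasDerivAt_dnDeriv₂ k.2 x).ofReal_comp.congr_deriv (Complex.ofReal_mul _ _)

/-! ### The kernels, and non-negativity of L₋ -/

variable [NeZero N]

theorem ker_Lminus_le : ker (Lminus N k) ≤ Submodule.span ℂ {toL2 (dnCircle N k)} := by
  intro f hf
  obtain ⟨u, p, rfl, hu, hp⟩ := mem_ker_iff_exists_isDeriv.1 hf
  have hT : 0 < period N k := Fact.out
  have hpos : ∀ x, (dn k x : ℂ) ≠ 0 := fun x => by exact_mod_cast (dn_pos k.2 x).ne'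
  have hW := wronskian_eq hu hp (isDeriv_dnCircle N k) (isDeriv_dnDerivCircle N k)
  simp only [ofRealCont, ContinuousMap.coe_mk, dnCircle_coe, dnDerivCircle_coe] at hW
  set w : ℂ := u ((0 : ℝ) : AddCircle (period N k)) * dnDeriv k 0
    - p ((0 : ℝ) : AddCircle (period N k)) * dn k 0
  have hdiv : ∀ x : ℝ, HasDerivAt (fun x : ℝ => u (x : AddCircle (period N k)) / (dn k x : ℂ))
      (-w * ((1 / dn k x ^ 2 : ℝ) : ℂ)) x := fun x => by
    refine ((hu x).div (isDeriv_dnCircle N k x) (hpos x)).congr_deriv ?_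
    change (p (x : AddCircle (period N k)) * (dn k x : ℂ)
      - u (x : AddCircle (period N k)) * (dnDerivCircle N k (x : AddCircle (period N k)) : ℂ)) /
      (dn k x : ℂ) ^ 2 = _
    rw [dnDerivCircle_coe]
    push_cast
    have := hpos x
    field_simp
    linear_combination -hW x
  have hc : Continuous fun x => 1 / dn k x ^ 2 :=
    continuous_const.div ((continuous_dn k.2).pow 2) fun x => pow_ne_zero 2 (dn_pos k.2 x).ne'
  -- The quotient u/dn is periodic, so -w ∫ dn⁻² = 0 over a period, with a positive integral.
  have hw : w = 0 := by
    have h1 := intervalIntegral.integral_eq_sub_of_hasDerivAt (a := 0) (b := period N k)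
      (fun x _ => hdiv x) (Continuous.intervalIntegrable (by fun_prop) _ _)
    have h2 := periodic_dn_period N k 0
    rw [zero_add] at h2
    rw [AddCircle.coe_period, h2, QuotientAddGroup.mk_zero, sub_self,
      intervalIntegral.integral_const_mul, intervalIntegral.integral_ofReal] at h1
    have h3 : 0 < ∫ x in (0 : ℝ)..period N k, 1 / dn k x ^ 2 :=
      intervalIntegral.intervalIntegral_pos_of_pos (hc.intervalIntegrable _ _)
        (fun x => one_div_pos.2 (pow_pos (dn_pos k.2 x) 2)) hT
    have h4 : ((∫ x in (0 : ℝ)..period N k, 1 / dn k x ^ 2 : ℝ) : ℂ) ≠ 0 := by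
      exact_mod_cast h3.ne'
    exact neg_eq_zero.1 ((mul_eq_zero.1 h1).resolve_right h4)
  rw [hw, neg_zero] at hdiv
  simp only [zero_mul] at hdiv
  rw [Submodule.mem_span_singleton]
  refine ⟨u ((0 : ℝ) : AddCircle (period N k)) / (dn k 0 : ℂ), ?_⟩
  rw [toL2_eq_contToL2, ← map_smul]
  congr 1
  ext z
  obtain ⟨x, rfl⟩ := QuotientAddGroup.mk_surjective z
  have h := is_const_of_deriv_eq_zero (fun x => (hdiv x).differentiableAt)
    (fun x => (hdiv x).deriv) x 0
  change _ * (dn k x : ℂ) = _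
  rw [← h, div_mul_cancel₀ _ (hpos x)]

theorem ker_Lplus_le : ker (Lplus N k) ≤ Submodule.span ℂ {toL2 (sncnCircle N k)} := by
  intro f hf
  obtain ⟨u, p, rfl, hu, hp⟩ := mem_ker_iff_exists_isDeriv.1 hf
  have hT : 0 < period N k := Fact.out
  have hdT := periodic_dn_period N k 0
  have hdT' := periodic_dnDeriv_period N k 0
  rw [zero_add] at hdT hdT'
  have hWs := wronskian_eq hu hp (fun x => (hasDerivAt_secondSol k.2 x).ofReal_comp) fun x =>
    (hasDerivAt_secondSolDeriv k.2 x).ofReal_comp.congr_deriv (Complex.ofReal_mul _ _)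
  have hWd := wronskian_eq hu hp (fun x => (hasDerivAt_dnDeriv k.2 x).ofReal_comp) fun x =>
    (hasDerivAt_dnDeriv₂ k.2 x).ofReal_comp.congr_deriv (Complex.ofReal_mul _ _)
  have hWr := wronskian_eq (fun x => (hasDerivAt_secondSol k.2 x).ofReal_comp)
    (q := fun x => ((-6 * dn k x ^ 2 - (k : ℝ) ^ 2 + 2 : ℝ) : ℂ))
    (fun x => (hasDerivAt_secondSolDeriv k.2 x).ofReal_comp.congr_deriv (Complex.ofReal_mul _ _))
    (fun x => (hasDerivAt_dnDeriv k.2 x).ofReal_comp) fun x =>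
    (hasDerivAt_dnDeriv₂ k.2 x).ofReal_comp.congr_deriv (Complex.ofReal_mul _ _)
  have hI0 : secondSolInt (k : ℝ) 0 = 0 := intervalIntegral.integral_same
  have hs0 : secondSol (k : ℝ) 0 = (k : ℝ) ^ 2 - 1 - secondSolConst k := by
    rw [secondSol, dnDeriv_zero k.2, dn_zero k.2]; ring
  have hs0' : secondSolDeriv (k : ℝ) 0 = 0 := by
    rw [secondSolDeriv, dnDeriv_zero k.2, dn_zero k.2, hI0]; ring
  have hk : (k : ℝ) ^ 2 ≠ 0 := pow_ne_zero 2 k.2.1.ne'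
  -- Between 0 and the period T, only the derivative of `secondSol` changes in its Wronskian with u,
  -- so u(0) k² J(T) = 0.
  have hu0 : u ((0 : ℝ) : AddCircle (period N k)) = 0 := by
    have h := hWs (period N k)
    have hI := secondSolInt_pos k.2 hT (periodic_dn_period N k) (periodic_dnDeriv_period N k)
    have hsT : secondSol (k : ℝ) (period N k) = secondSol k 0 := by
      rw [hs0, secondSol, hdT, hdT', dnDeriv_zero k.2, dn_zero k.2]; ring
    have hsT' : secondSolDeriv (k : ℝ) (period N k) = (k : ℝ) ^ 2 * secondSolInt k (period N k) := by
      rw [secondSolDeriv, hdT, hdT', dnDeriv_zero k.2, dn_zero k.2]; ring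
    rw [hsT, hsT', hs0', AddCircle.coe_period, ← QuotientAddGroup.mk_zero] at h
    have h1 : u ((0 : ℝ) : AddCircle (period N k)) *
        (((k : ℝ) ^ 2 * secondSolInt k (period N k) : ℝ) : ℂ) = 0 := by
      simpa using h
    refine (mul_eq_zero.1 h1).resolve_right ?_
    exact_mod_cast mul_ne_zero hk hI.ne'
  -- The Wronskian of `secondSol` and dn' at 0, where dn'' = -k². It is nonzero because k² - 1 - α =
  -- k²(1 - k²)/(2 - k²).
  set w : ℝ := ((k : ℝ) ^ 2 - 1 - secondSolConst k) * -(k : ℝ) ^ 2 with hwdef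
  have hw : w ≠ 0 := by
    refine mul_ne_zero (fun h => ?_) (neg_ne_zero.2 hk)
    have h1 : (1 - (k : ℝ) ^ 2) * (k : ℝ) ^ 2 = 0 := by
      linear_combination (2 - (k : ℝ) ^ 2) * h + secondSolConst_mul k.2
    exact mul_ne_zero (one_sub_sq_pos k.2).ne' hk h1
  have hwC : (w : ℂ) ≠ 0 := by exact_mod_cast hw
  set w₀ : ℂ := p ((0 : ℝ) : AddCircle (period N k)) * secondSol k 0
  -- Cramer's rule: eliminating u' from the Wronskians of u with the two solutions expresses u in
  -- that basis, and u(0) = 0 kills the `secondSol` component.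
  have key : ∀ x : ℝ, u (x : AddCircle (period N k)) * w = w₀ * dnDeriv k x := fun x => by
    have h1 := hWs x
    have h2 := hWd x
    have h3 := hWr x
    rw [hu0, zero_mul, zero_sub] at h1
    rw [hu0, dnDeriv_zero k.2, Complex.ofReal_zero, zero_mul, mul_zero, sub_zero] at h2
    rw [dnDeriv_zero k.2, Complex.ofReal_zero, mul_zero, sub_zero, hs0, dn_zero k.2] at h3
    have h4 : (w : ℂ) = (((k : ℝ) ^ 2 - 1 - secondSolConst k : ℝ) : ℂ) *
        (((2 - (k : ℝ) ^ 2) * 1 - 2 * 1 ^ 3 : ℝ) : ℂ) := by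
      rw [← Complex.ofReal_mul, hwdef]
      congr 1
      ring
    rw [h4]
    linear_combination -u (x : AddCircle (period N k)) * h3 + (secondSol k x : ℂ) * h2
      - (dnDeriv k x : ℂ) * h1
  rw [Submodule.mem_span_singleton]
  refine ⟨w₀ / w * (-(k : ℂ) ^ 2), ?_⟩
  rw [toL2_eq_contToL2, ← map_smul]
  congr 1
  ext z
  obtain ⟨x, rfl⟩ := QuotientAddGroup.mk_surjective z
  change _ * ((sn k x * cn k x : ℝ) : ℂ) = u (x : AddCircle (period N k))
  rw [eq_comm, ← mul_left_inj' hwC, key x, dnDeriv]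
  push_cast
  field_simp

theorem dnCircle_mem_ker : toL2 (dnCircle N k) ∈ ker (Lminus N k) :=
  mem_ker_iff_exists_isDeriv.2
    ⟨_, _, (toL2_eq_contToL2 _).symm, isDeriv_dnCircle N k, isDeriv_dnDerivCircle N k⟩

theorem sncnCircle_mem_ker : toL2 (sncnCircle N k) ∈ ker (Lplus N k) := by
  have h : contToL2 (ofRealCont (dnDerivCircle N k)) ∈ ker (Lplus N k) :=
    mem_ker_iff_exists_isDeriv.2
      ⟨_, _, rfl, isDeriv_dnDerivCircle' N k, isDeriv_dnDeriv₂Circle N k⟩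
  have hk : -((k : ℝ) : ℂ) ^ 2 ≠ 0 := neg_ne_zero.2 (pow_ne_zero 2 (by exact_mod_cast k.2.1.ne'))
  have e : ofRealCont (dnDerivCircle N k) =
      (-((k : ℝ) : ℂ) ^ 2) • ofRealCont (sncnCircle N k) := by
    ext z
    change ((-(k : ℝ) ^ 2 * sncnCircle N k z : ℝ) : ℂ) = _ * (sncnCircle N k z : ℂ)
    push_cast
    rfl
  rw [e, map_smul, ← toL2_eq_contToL2] at h
  exact (Submodule.smul_mem_iff _ hk).1 h

/-- Positivity of dn makes r = dn'/dn a continuous periodic function, and r' + r² = dn''/dn is the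
potential. -/
theorem Lminus_nonneg (f : (Lminus N k).domain) :
    0 ≤ (inner ℂ (f : L2per (period N k)) (Lminus N k f)).re := by
  let r : C(AddCircle (period N k), ℝ) :=
    ⟨fun z => dnDerivCircle N k z / dnCircle N k z, by
      refine Continuous.div (by fun_prop) (by fun_prop) fun z => ?_
      obtain ⟨x, rfl⟩ := QuotientAddGroup.mk_surjective z
      exact (dn_pos k.2 x).ne'⟩
  refine schrodinger_nonneg_of_riccati (V := potentialMinus N k) (r := r) (fun x => ?_) f
  refine (hasDerivAt_dnDeriv_div_dn k.2 x).congr_deriv ?_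
  change _ = (-2 * dn k x ^ 2 - (k : ℝ) ^ 2 + 2) - (dnDeriv k x / dn k x) ^ 2
  have := (dn_pos k.2 x).ne'
  rw [div_pow, dnDeriv_sq k.2]
  field_simp
  ring

end Jacobi

end

theorem proposition1 (N : ℕ) [NeZero N] (k : Set.Ioo (0 : ℝ) 1) :
    (IsSelfAdjoint (Jacobi.Lminus N k) ∧
      (∀ f : (Jacobi.Lminus N k).domain,
        0 ≤ (inner ℂ (f : PeriodicSchrodinger.L2per (Jacobi.period N k))
          (Jacobi.Lminus N k f)).re) ∧
      PeriodicSchrodinger.ker (Jacobi.Lminus N k) =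
        Submodule.span ℂ {PeriodicSchrodinger.toL2 (Jacobi.dnCircle N k)}) ∧
    (IsSelfAdjoint (Jacobi.Lplus N k) ∧
      PeriodicSchrodinger.ker (Jacobi.Lplus N k) =
        Submodule.span ℂ {PeriodicSchrodinger.toL2 (Jacobi.sncnCircle N k)}) := by
  refine ⟨⟨PeriodicSchrodinger.isSelfAdjoint_schrodinger _, Jacobi.Lminus_nonneg N k,
    le_antisymm (Jacobi.ker_Lminus_le N k) ?_⟩,
    PeriodicSchrodinger.isSelfAdjoint_schrodinger _,
    le_antisymm (Jacobi.ker_Lplus_le N k) ?_⟩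
  · exact (Submodule.span_singleton_le_iff_mem _ _).2 (Jacobi.dnCircle_mem_ker N k)
  · exact (Submodule.span_singleton_le_iff_mem _ _).2 (Jacobi.sncnCircle_mem_ker N k)
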